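/- Let $\mathbf{CMet}$ be the category whose objects are complete metric spaces and whose morphisms are short maps (functions $f$ with $d(f(x),f(x'))\le d(x,x')$). It is a symmetric monoidal category with $X\otimes Y$ the set $X\times Y$ with metric $d((x,y),(x',y'))=d(x,x')+d(y,y')$, with the one-point space $1$ as unit, and with the evident associator, unitors and swap. For a complete metric space $X$ let $PX$ be the set of Radon probability measures $p$ on $X$ (Borel probability measures that are inner regular with respect to compact sets) with finite first moment, i.e. such that every short map $f:X\to\mathbb R$ is $p$-integrable, with the metric $$d(p,q)=\sup_{f:X\to\mathbb R\ \text{short}}\left|\int f\,dp-\int f\,dq\right| .$$ For $f:X\to Y$ short let $Pf:PX\to PY$ be the push-forward $p\mapsto f_*p$. With the unit $\delta:X\to PX$, $x\mapsto\delta_x$ (Dirac measures), and the multiplication $E:PPX\to PX$, $\int f\,d(E\mu)=\int_{PX}\left(\int_X f\,dp\right)d\mu(p)$ for all short $f$, this is a monad on $\mathbf{CMet}$, the Kantorovich monad. A symmetric bimonoidal monad on a symmetric monoidal category is a monad $(T,\delta,E)$ together with a lax monoidal structure $(\eta:1\to T1,\ \nabla:TX\otimes TY\to T(X\otimes Y))$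 and an oplax monoidal structure $(\epsilon:T1\to1,\ \Delta:T(X\otimes Y)\to TX\otimes TY)$ on the functor $T$, both commuting with the braiding, such that 1. (bimonoidality) for all $W,X,Y,Z$ the two composites $T(W\otimes X)\otimes T(Y\otimes Z)\to T(W\otimes Y)\otimes T(X\otimes Z)$, $$\Delta_{W\otimes Y,X\otimes Z}\circ T(\mathrm{swap})\circ\nabla_{W\otimes X,Y\otimes Z}\quad\text{and}\quad(\nabla_{W,Y}\otimes\nabla_{X,Z})\circ\mathrm{swap}\circ(\Delta_{W,X}\otimes\Delta_{Y,Z}),$$ agree, where $\mathrm{swap}$ exchanges the two middle factors; 2. up to the unitors, $\epsilon\circ\eta=\mathrm{id}_1$, $\Delta_{1,1}\circ\eta=\eta\otimes\eta$ and $\epsilon\circ\nabla_{1,1}=\epsilon\otimes\epsilon$; 3. $\delta:\mathrm{id}\Rightarrow T$ and $E:TT\Rightarrow T$ are both lax and oplax monoidal natural transformations. **Theorem.** The Kantorovich monad is a symmetric bimonoidal monad on $\mathbf{CMet}$, with the following structure. The monoidal structure $\nabla:PX\otimes PY\to P(X\otimes Y)$ is the product joint: for $p\in PX$, $q\in PY$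 and every short $f:X\otimes Y\to\mathbb R$, $$\int f\,d\nabla(p,q)=\int_X\int_Y f(x,y)\,dq(y)\,dp(x)=\int_Y\int_X f(x,y)\,dp(x)\,dq(y).$$ The opmonoidal structure $\Delta:P(X\otimes Y)\to PX\otimes PY$ is the pair of marginals: $\Delta(r)=(r_X,r_Y)$ with $\int_X f\,dr_X=\int f(x)\,dr(x,y)$ for every short $f:X\to\mathbb R$ and $\int_Y g\,dr_Y=\int g(y)\,dr(x,y)$ for every short $g:Y\to\mathbb R$. -/

import Mathlib

open CategoryTheory MonoidalCategory MeasureTheory ProbabilityTheory Filter Topology Set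
open scoped ENNReal NNReal BoundedContinuousFunction

universe u

/-- The Kantorovich space `PX` of a metric space `X`: Radon probability measures on `X`
(Borel probability measures that are inner regular with respect to compact sets) of finite first
moment, i.e. against which every short map `X → ℝ` is integrable. -/
@[ext]
structure Kant (X : Type u) [MetricSpace X] [MeasurableSpace X] [BorelSpace X] where
  measure : Measure X
  isProb : IsProbabilityMeasure measure
  innerRegular : measure.InnerRegular
  integrable : ∀ f : X → ℝ, LipschitzWith 1 f → Integrable f measure

namespace Kant

attribute [instance] Kant.isProb Kant.innerRegular

section Metric

variable {X : Type u} [MetricSpace X] [MeasurableSpace X] [BorelSpace X]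

/-- The Kantorovich distance `sup_f |∫ f dp - ∫ f dq|`, over all short maps `f : X → ℝ`. -/
noncomputable instance instDist : Dist (Kant X) where
  dist p q := ⨆ f : {f : X → ℝ // LipschitzWith 1 f},
    |∫ x, f.1 x ∂p.measure - ∫ x, f.1 x ∂q.measure|

theorem dist_def (p q : Kant X) : dist p q = ⨆ f : {f : X → ℝ // LipschitzWith 1 f},
    |∫ x, f.1 x ∂p.measure - ∫ x, f.1 x ∂q.measure| := rfl

instance : Nonempty {f : X → ℝ // LipschitzWith 1 f} :=
  ⟨⟨fun _ => 0, (LipschitzWith.const 0).weaken zero_le_one⟩⟩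

theorem bddAbove (p q : Kant X) : BddAbove (Set.range
    fun f : {f : X → ℝ // LipschitzWith 1 f} =>
      |∫ x, f.1 x ∂p.measure - ∫ x, f.1 x ∂q.measure|) := by
  obtain ⟨x₀⟩ : Nonempty X := p.measure.nonempty_of_neZero
  have key : ∀ (r : Kant X) (f : X → ℝ), LipschitzWith 1 f →
      |∫ x, f x ∂r.measure - f x₀| ≤ ∫ x, dist x x₀ ∂r.measure := by
    intro r f hf
    have h1 : ∫ x, f x ∂r.measure - f x₀ = ∫ x, (f x - f x₀) ∂r.measure := by
      rw [integral_sub (r.integrable f hf) (integrable_const _)]; simp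
    rw [h1]
    refine (abs_integral_le_integral_abs).trans (integral_mono_of_nonneg ?_
      (r.integrable _ (LipschitzWith.dist_left x₀)) ?_)
    · exact Eventually.of_forall fun x => abs_nonneg _
    · refine Eventually.of_forall fun x => ?_
      have := hf.dist_le_mul x x₀
      simpa [Real.dist_eq] using this
  refine ⟨∫ x, dist x x₀ ∂p.measure + ∫ x, dist x x₀ ∂q.measure, ?_⟩
  rintro _ ⟨f, rfl⟩
  have h1 := key p f.1 f.2
  have h2 := key q f.1 f.2
  rw [abs_le] at h1 h2
  simp only
  rw [abs_le]
  constructor <;> linarith [h1.1, h1.2, h2.1, h2.2]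

theorem abs_integral_sub_le (p q : Kant X) {f : X → ℝ} (hf : LipschitzWith 1 f) :
    |∫ x, f x ∂p.measure - ∫ x, f x ∂q.measure| ≤ dist p q :=
  le_ciSup (bddAbove p q) ⟨f, hf⟩

theorem dist_le_of_forall {p q : Kant X} {C : ℝ}
    (h : ∀ f : X → ℝ, LipschitzWith 1 f →
      |∫ x, f x ∂p.measure - ∫ x, f x ∂q.measure| ≤ C) : dist p q ≤ C :=
  ciSup_le fun f => h f.1 f.2

theorem integrable_of_lipschitz (p : Kant X) {K : ℝ≥0} {f : X → ℝ} (hf : LipschitzWith K f) :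
    Integrable f p.measure := by
  have hK : (0 : ℝ) < (K : ℝ) + 1 := by positivity
  have h : LipschitzWith 1 fun x => ((K : ℝ) + 1)⁻¹ * f x := by
    refine LipschitzWith.of_dist_le_mul fun x y => ?_
    have := hf.dist_le_mul x y
    rw [Real.dist_eq, ← mul_sub, abs_mul, abs_of_pos (inv_pos.2 hK), ← Real.dist_eq,
      inv_mul_le_iff₀ hK]
    simp only [NNReal.coe_one, one_mul]
    nlinarith [dist_nonneg (x := x) (y := y)]
  have h2 := (p.integrable _ h).const_mul ((K : ℝ) + 1)
  refine h2.congr (Eventually.of_forall fun x => ?_)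
  simp only
  field_simp

theorem abs_integral_sub_le_of_lipschitz (p q : Kant X) {K : ℝ≥0} {f : X → ℝ}
    (hf : LipschitzWith K f) :
    |∫ x, f x ∂p.measure - ∫ x, f x ∂q.measure| ≤ K * dist p q := by
  rcases eq_or_ne K 0 with rfl | hK0
  · obtain ⟨x₀⟩ : Nonempty X := p.measure.nonempty_of_neZero
    have : f = fun _ => f x₀ := by
      funext x
      have := hf.dist_le_mul x x₀
      simp only [NNReal.coe_zero, zero_mul] at this
      exact dist_le_zero.1 this
    rw [this]; simp
  have hK : (0 : ℝ) < K := by positivity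
  have h : LipschitzWith 1 fun x => (K : ℝ)⁻¹ * f x := by
    refine LipschitzWith.of_dist_le_mul fun x y => ?_
    have := hf.dist_le_mul x y
    rw [Real.dist_eq, ← mul_sub, abs_mul, abs_of_pos (inv_pos.2 hK), ← Real.dist_eq,
      inv_mul_le_iff₀ hK]
    simpa using this
  have := abs_integral_sub_le p q h
  rwa [integral_const_mul, integral_const_mul, ← mul_sub, abs_mul, abs_of_pos (inv_pos.2 hK),
    inv_mul_le_iff₀ hK] at this

/-- Lipschitz approximations of the indicator of `F`. -/
theorem lipschitz_thick {X : Type u} [MetricSpace X] (n : ℕ) (F : Set X) : LipschitzWith (1 / ((n : ℝ) + 1)).toNNReal⁻¹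
    (fun x => (thickenedIndicator (Nat.one_div_pos_of_nat (n := n) (α := ℝ)) F x : ℝ)) := by
  have := lipschitzWith_thickenedIndicator (Nat.one_div_pos_of_nat (n := n) (α := ℝ)) F
  intro x y
  exact this x y

theorem tendsto_thick (p : Kant X) {F : Set X} (hF : IsClosed F) :
    Tendsto (fun n : ℕ => ∫ x,
      (thickenedIndicator (Nat.one_div_pos_of_nat (n := n) (α := ℝ)) F x : ℝ) ∂p.measure)
      atTop (𝓝 (p.measure.real F)) :=
  tendsto_integral_thickenedIndicator_of_isClosed p.measure hF
    (fun _ => Nat.one_div_pos_of_nat) tendsto_one_div_add_atTop_nhds_zero_nat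

theorem ext_of_integral {p q : Kant X}
    (h : ∀ f : X → ℝ, LipschitzWith 1 f → ∫ x, f x ∂p.measure = ∫ x, f x ∂q.measure) :
    p = q := by
  have h0 : dist p q ≤ 0 := dist_le_of_forall fun f hf => by rw [h f hf]; simp
  have h0' : 0 ≤ dist p q :=
    (abs_nonneg _).trans (abs_integral_sub_le p q ((LipschitzWith.const 0).weaken zero_le_one))
  have h1 : dist p q = 0 := le_antisymm h0 h0'
  have hcl : ∀ F : Set X, IsClosed F → p.measure F = q.measure F := by
    intro F hF
    have : p.measure.real F = q.measure.real F := by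
      refine tendsto_nhds_unique (tendsto_thick p hF) ?_
      refine (tendsto_thick q hF).congr fun n => ?_
      have := abs_integral_sub_le_of_lipschitz p q (lipschitz_thick n F)
      rw [h1, mul_zero] at this
      linarith [abs_nonpos_iff.1 this]
    rwa [measureReal_eq_measureReal_iff] at this
  apply Kant.ext
  apply ext_of_generate_finite _ ?_ isPiSystem_isClosed
  · exact fun F hF => hcl F hF
  · exact hcl _ isClosed_univ
  · rw [BorelSpace.measurable_eq (α := X), borel_eq_generateFrom_isClosed]

noncomputable instance instMetricSpace : MetricSpace (Kant X) where
  dist_self p := le_antisymm (dist_le_of_forall fun f _ => by simp)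
    ((abs_nonneg _).trans (abs_integral_sub_le p p ((LipschitzWith.const 0).weaken zero_le_one)))
  dist_comm p q := by
    simp only [dist_def]
    exact iSup_congr fun f => abs_sub_comm _ _
  dist_triangle p q r := dist_le_of_forall fun f hf =>
    (abs_sub_le _ (∫ x, f x ∂q.measure) _).trans
      (add_le_add (abs_integral_sub_le p q hf) (abs_integral_sub_le q r hf))
  eq_of_dist_eq_zero {p q} h := ext_of_integral fun f hf => by
    have := abs_integral_sub_le p q hf
    rw [h] at this
    linarith [abs_nonpos_iff.1 this]

theorem short_integral {f : X → ℝ} (hf : LipschitzWith 1 f) :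
    LipschitzWith 1 fun p : Kant X => ∫ x, f x ∂p.measure :=
  LipschitzWith.of_dist_le_mul fun p q => by
    simpa [Real.dist_eq] using abs_integral_sub_le p q hf

theorem continuous_integral {K : ℝ≥0} {f : X → ℝ} (hf : LipschitzWith K f) :
    Continuous fun p : Kant X => ∫ x, f x ∂p.measure :=
  (LipschitzWith.of_dist_le_mul (K := K) fun p q => by
    simpa [Real.dist_eq] using abs_integral_sub_le_of_lipschitz p q hf).continuous

noncomputable instance instMeasurableSpace : MeasurableSpace (Kant X) := borel (Kant X)

instance instBorelSpace : BorelSpace (Kant X) := ⟨rfl⟩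

theorem measurable_measure :
    Measurable (Kant.measure : Kant X → Measure X) := by
  refine Measurable.measure_of_isPiSystem_of_isProbabilityMeasure
    (S := {F : Set X | IsClosed F}) ?_ isPiSystem_isClosed ?_
  · rw [BorelSpace.measurable_eq (α := X), borel_eq_generateFrom_isClosed]
  · intro F hF
    have : Measurable fun p : Kant X => p.measure.real F :=
      measurable_of_tendsto_metrizable
        (fun n => (continuous_integral (lipschitz_thick n F)).measurable)
        (tendsto_pi_nhds.2 fun p => tendsto_thick p hF)
    have h2 := this.ennreal_ofReal
    convert h2 using 2 with p
    exact (ofReal_measureReal).symm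

theorem isClosed_setOf_full {A : Set X} (hA : IsClosed A) :
    IsClosed {p : Kant X | p.measure Aᶜ = 0} := by
  have : {p : Kant X | p.measure Aᶜ = 0} = ⋂ n : ℕ, {p : Kant X | 1 ≤ ∫ x,
      (thickenedIndicator (Nat.one_div_pos_of_nat (n := n) (α := ℝ)) A x : ℝ) ∂p.measure} := by
    ext p
    simp only [mem_ofPred_eq, mem_iInter]
    rw [prob_compl_eq_zero_iff hA.measurableSet]
    constructor
    · intro h n
      have : p.measure.real A = 1 := by simp [measureReal_def, h]
      refine this.symm.le.trans ?_
      rw [← integral_indicator_one hA.measurableSet]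
      refine integral_mono_of_nonneg (Eventually.of_forall fun x => ?_)
        (p.integrable_of_lipschitz (lipschitz_thick n A)) (Eventually.of_forall fun x => ?_)
      · exact indicator_nonneg (by simp) x
      · by_cases hx : x ∈ A
        · rw [indicator_of_mem hx]
          exact_mod_cast (thickenedIndicator_one Nat.one_div_pos_of_nat A hx).ge
        · simp [hx]
    · intro h
      have h1 := ge_of_tendsto' (tendsto_thick p hA) h
      have h2 : p.measure.real A = 1 := le_antisymm measureReal_le_one h1
      rw [measureReal_def] at h2
      rw [← ENNReal.ofReal_toReal (measure_ne_top p.measure A), h2, ENNReal.ofReal_one]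
  rw [this]
  exact isClosed_iInter fun n =>
    isClosed_le continuous_const (continuous_integral (lipschitz_thick n A))

theorem exists_isSeparable (p : Kant X) :
    ∃ A : Set X, IsClosed A ∧ TopologicalSpace.IsSeparable A ∧ p.measure Aᶜ = 0 := by
  have h := isTightMeasureSet_iff_exists_isCompact_measure_compl_le.1
    (isTightMeasureSet_singleton_of_innerRegular (μ := p.measure))
  have h' : ∀ n : ℕ, ∃ K : Set X, IsCompact K ∧ p.measure Kᶜ ≤ ((n : ℝ≥0∞) + 1)⁻¹ := by
    intro n
    obtain ⟨K, hK, h2⟩ := h ((n : ℝ≥0∞) + 1)⁻¹ (by simp)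
    exact ⟨K, hK, h2 _ rfl⟩
  choose K hK hK' using h'
  refine ⟨closure (⋃ n, K n), isClosed_closure, ?_, ?_⟩
  · exact (TopologicalSpace.IsSeparable.iUnion fun n => (hK n).isSeparable).closure
  · refine le_antisymm (ge_of_tendsto' (x := atTop) (f := fun n : ℕ => ((n : ℝ≥0∞) + 1)⁻¹)
      ?_ fun n => ?_) zero_le
    · have := (ENNReal.tendsto_inv_nat_nhds_zero).comp (tendsto_add_atTop_nat 1)
      refine this.congr fun n => ?_
      simp
    · refine (measure_mono ?_).trans (hK' n)
      exact compl_subset_compl.2 ((subset_iUnion K n).trans subset_closure)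

end Metric

theorem innerRegular_of_isSeparable {X : Type u} [MetricSpace X] [CompleteSpace X]
    [MeasurableSpace X] [BorelSpace X] {μ : Measure X} [IsFiniteMeasure μ] {A : Set X}
    (hA : IsClosed A) (hs : TopologicalSpace.IsSeparable A) (h : μ Aᶜ = 0) :
    μ.InnerRegular := by
  have : CompleteSpace A := hA.completeSpace_coe
  have : TopologicalSpace.SeparableSpace A := hs.separableSpace
  have : SecondCountableTopology A := UniformSpace.secondCountable_of_separable A
  have h1 : (μ.comap (Subtype.val : A → X)).map Subtype.val = μ := by
    rw [(MeasurableEmbedding.subtype_coe hA.measurableSet).map_comap, Subtype.range_coe]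
    exact Measure.restrict_eq_self_of_ae_mem h
  rw [← h1]
  have : IsFiniteMeasure (μ.comap (Subtype.val : A → X)) := by
    infer_instance
  exact Measure.InnerRegular.map_of_continuous continuous_subtype_val

end Kant
namespace Kant

section Complete

variable {X : Type u} [MetricSpace X] [CompleteSpace X] [MeasurableSpace X] [BorelSpace X]

theorem cauchySeq_finite_net {X : Type u} [MetricSpace X] [MeasurableSpace X] [BorelSpace X]
    {p : ℕ → Kant X} (hp : CauchySeq p) {ε δ : ℝ} (hε : 0 < ε)
    (hδ : 0 < δ) : ∃ t : Set X, t.Finite ∧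
      ∀ n, (p n).measure (⋃ x ∈ t, Metric.closedBall x δ)ᶜ ≤ ENNReal.ofReal ε := by
  obtain ⟨N, hN⟩ := Metric.cauchySeq_iff'.1 hp (ε / 2 * (δ / 2)) (by positivity)
  have hK : ∀ i, ∃ K : Set X, IsCompact K ∧ (p i).measure Kᶜ ≤ ENNReal.ofReal (ε / 2) := by
    intro i
    obtain ⟨K, hK, h2⟩ := isTightMeasureSet_iff_exists_isCompact_measure_compl_le.1
      (isTightMeasureSet_singleton_of_innerRegular (μ := (p i).measure))
      (ENNReal.ofReal (ε / 2)) (by simpa using hε)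
    exact ⟨K, hK, h2 _ rfl⟩
  choose K hK hKm using hK
  let L : Set X := ⋃ i ∈ Iic N, K i
  have hL : IsCompact L := (finite_Iic N).isCompact_biUnion fun i _ => hK i
  have hLm : ∀ i ≤ N, (p i).measure Lᶜ ≤ ENNReal.ofReal (ε / 2) := fun i hi =>
    (measure_mono (compl_subset_compl.2
      (subset_biUnion_of_mem (u := K) (show i ∈ Iic N from hi)))).trans (hKm i)
  obtain ⟨t, -, ht, htL⟩ := finite_cover_balls_of_compact hL (half_pos hδ)
  refine ⟨t, ht, fun n => ?_⟩
  have hδ2 := half_pos hδ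
  have hsub : Metric.thickening (δ / 2) L ⊆ ⋃ x ∈ t, Metric.closedBall x δ := by
    intro y hy
    obtain ⟨z, hz, hyz⟩ := Metric.mem_thickening_iff.1 hy
    obtain ⟨x, hx, hzx⟩ := mem_iUnion₂.1 (htL hz)
    refine mem_iUnion₂.2 ⟨x, hx, ?_⟩
    rw [Metric.mem_ball] at hzx
    rw [Metric.mem_closedBall]
    linarith [dist_triangle y z x]
  rcases le_total n N with hn | hn
  · refine (measure_mono (compl_subset_compl.2 ?_)).trans ((hLm n hn).trans
      (ENNReal.ofReal_le_ofReal (by linarith)))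
    exact (Metric.self_subset_thickening hδ2 L).trans hsub
  · let g : X → ℝ := fun x => (thickenedIndicator hδ2 L x : ℝ)
    have hg : LipschitzWith (δ / 2).toNNReal⁻¹ g := fun x y =>
      lipschitzWith_thickenedIndicator hδ2 L x y
    have h1 : (p N).measure.real L ≤ ∫ x, g x ∂(p N).measure := by
      rw [← integral_indicator_one hL.isClosed.measurableSet]
      refine integral_mono_of_nonneg (Eventually.of_forall fun x => ?_)
        ((p N).integrable_of_lipschitz hg) (Eventually.of_forall fun x => ?_)
      · exact indicator_nonneg (by simp) x
      · by_cases hx : x ∈ L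
        · rw [indicator_of_mem hx]
          exact_mod_cast (thickenedIndicator_one hδ2 L hx).ge
        · simp [hx, g]
    have hm : MeasurableSet (Metric.thickening (δ / 2) L) :=
      Metric.isOpen_thickening.measurableSet
    have h2 : ∫ x, g x ∂(p n).measure ≤ (p n).measure.real (Metric.thickening (δ / 2) L) := by
      rw [← integral_indicator_one hm]
      refine integral_mono_of_nonneg (Eventually.of_forall fun x => by simp [g])
        ((integrable_const (1 : ℝ)).indicator hm) (Eventually.of_forall fun x => ?_)
      by_cases hx : x ∈ Metric.thickening (δ / 2) L
      · simpa [hx, g] using thickenedIndicator_le_one hδ2 L x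
      · rw [indicator_of_notMem hx]
        exact_mod_cast (thickenedIndicator_zero hδ2 L hx).le
    have h3 := abs_integral_sub_le_of_lipschitz (p n) (p N) hg
    have h4 : (((δ / 2).toNNReal⁻¹ : ℝ≥0) : ℝ) * dist (p n) (p N) ≤ ε / 2 := by
      rw [NNReal.coe_inv, Real.coe_toNNReal _ hδ2.le, inv_mul_le_iff₀ hδ2]
      linarith [hN n hn]
    have h5 : (p N).measure.real Lᶜ ≤ ε / 2 :=
      ENNReal.toReal_le_of_le_ofReal (by positivity) (hLm N le_rfl)
    rw [probReal_compl_eq_one_sub hL.isClosed.measurableSet] at h5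
    have h6 : (p n).measure.real (Metric.thickening (δ / 2) L)ᶜ ≤ ε := by
      rw [probReal_compl_eq_one_sub hm]
      linarith [(abs_le.1 (h3.trans h4)).1]
    refine (measure_mono (compl_subset_compl.2 hsub)).trans ?_
    rw [← ofReal_measureReal (μ := (p n).measure)]
    exact ENNReal.ofReal_le_ofReal h6

theorem cauchySeq_tight {p : ℕ → Kant X} (hp : CauchySeq p) {ε : ℝ} (hε : 0 < ε) :
    ∃ C : Set X, IsCompact C ∧ ∀ n, (p n).measure Cᶜ ≤ ENNReal.ofReal ε := by
  have h := fun k : ℕ => cauchySeq_finite_net hp (ε := ε / 2 / 2 ^ k) (δ := 1 / ((k : ℝ) + 1))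
    (by positivity) Nat.one_div_pos_of_nat
  choose t ht htm using h
  have hcl : IsClosed (⋂ k, ⋃ x ∈ t k, Metric.closedBall x (1 / ((k : ℝ) + 1))) :=
    isClosed_iInter fun k => (ht k).isClosed_biUnion fun x _ => Metric.isClosed_closedBall
  refine ⟨⋂ k, ⋃ x ∈ t k, Metric.closedBall x (1 / ((k : ℝ) + 1)), ?_, fun n => ?_⟩
  · refine isCompact_iff_totallyBounded_isComplete.2 ⟨?_, hcl.isComplete⟩
    refine Metric.totallyBounded_iff.2 fun r hr => ?_
    obtain ⟨k, hk⟩ := exists_nat_one_div_lt hr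
    refine ⟨t k, ht k, (iInter_subset _ k).trans (iUnion₂_mono fun x _ => ?_)⟩
    exact Metric.closedBall_subset_ball hk
  · rw [compl_iInter]
    refine (measure_iUnion_le _).trans ((ENNReal.tsum_le_tsum fun k => htm k n).trans ?_)
    rw [← ENNReal.ofReal_tsum_of_nonneg (fun k => by positivity) (summable_geometric_two' ε),
      tsum_geometric_two' ε]

theorem tendsto_clamp (a : ℝ) :
    Tendsto (fun M : ℕ => max (-(M : ℝ)) (min a M)) atTop (𝓝 a) := by
  refine tendsto_const_nhds.congr' ?_
  filter_upwards [eventually_ge_atTop ⌈|a|⌉₊] with M hM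
  have : |a| ≤ M := (Nat.le_ceil _).trans (by exact_mod_cast hM)
  rw [abs_le] at this
  rw [min_eq_left this.2, max_eq_right this.1]

theorem abs_clamp_le (a : ℝ) (M : ℕ) : |max (-(M : ℝ)) (min a M)| ≤ M := by
  rw [abs_le]
  exact ⟨le_max_left _ _, max_le (by linarith [(Nat.cast_nonneg M : (0 : ℝ) ≤ M)])
    (min_le_right _ _)⟩

theorem abs_clamp_le_abs (a : ℝ) (M : ℕ) : |max (-(M : ℝ)) (min a M)| ≤ |a| := by
  have hM : (0 : ℝ) ≤ M := Nat.cast_nonneg M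
  rw [abs_le]
  refine ⟨le_max_of_le_right (le_min (neg_abs_le a) ?_), max_le ?_ ((min_le_left _ _).trans
    (le_abs_self a))⟩
  · linarith [abs_nonneg a]
  · linarith [abs_nonneg a]

theorem short_clamp {X : Type u} [MetricSpace X] {f : X → ℝ} (hf : LipschitzWith 1 f) (M : ℕ) :
    LipschitzWith 1 fun x => max (-(M : ℝ)) (min (f x) M) :=
  (hf.min_const (M : ℝ)).const_max (-(M : ℝ))

theorem tendsto_integral_clamp {X : Type u} [MetricSpace X] [MeasurableSpace X] [BorelSpace X]
    {μ : Measure X} {f : X → ℝ} (hf : Continuous f)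
    (hi : Integrable f μ) :
    Tendsto (fun M : ℕ => ∫ x, max (-(M : ℝ)) (min (f x) M) ∂μ) atTop (𝓝 (∫ x, f x ∂μ)) := by
  refine tendsto_integral_of_dominated_convergence (fun x => |f x|) (fun M => ?_) hi.abs
    (fun M => Eventually.of_forall fun x => ?_) (Eventually.of_forall fun x => tendsto_clamp _)
  · exact (continuous_const.max (hf.min continuous_const)).aestronglyMeasurable
  · exact abs_clamp_le_abs _ _

theorem exists_limit {p : ℕ → Kant X} (hp : CauchySeq p) : ∃ q, Tendsto p atTop (𝓝 q) := by
  obtain ⟨u, -, u_pos, u_lim⟩ :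
      ∃ u : ℕ → ℝ≥0, StrictAnti u ∧ (∀ n, 0 < u n) ∧ Tendsto u atTop (𝓝 0) :=
    exists_seq_strictAnti_tendsto 0
  have hC := fun m : ℕ => cauchySeq_tight hp (ε := u m) (by exact_mod_cast u_pos m)
  choose C hC hCm using hC
  let P : ℕ → ProbabilityMeasure X := fun n => ⟨(p n).measure, (p n).isProb⟩
  have hcomp := isCompact_setOfPred_probabilityMeasure_mass_eq_compl_isCompact_le (E := X) u_lim hC
    (Or.inl inferInstance)
  have hPmem : ∀ n, P n ∈ {μ : ProbabilityMeasure X | ∀ n, μ (C n)ᶜ ≤ u n} := by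
    intro n m
    have := hCm m n
    rw [ENNReal.ofReal_coe_nnreal] at this
    rw [← ENNReal.coe_le_coe, ProbabilityMeasure.ennreal_coeFn_eq_coeFn_toMeasure]
    exact this
  let 𝒰 : Ultrafilter ℕ := Ultrafilter.of atTop
  have h𝒰 : (𝒰 : Filter ℕ) ≤ atTop := Ultrafilter.of_le atTop
  obtain ⟨μ, hμ, hlim⟩ := hcomp.ultrafilter_le_nhds (𝒰.map P) (by
    rw [le_principal_iff, Ultrafilter.coe_map, mem_map]
    exact Filter.univ_mem' hPmem)
  have hlim' : Tendsto P 𝒰 (𝓝 μ) := hlim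
  rw [ProbabilityMeasure.tendsto_iff_forall_integral_tendsto] at hlim'
  have hbd : ∀ f : X → ℝ, LipschitzWith 1 f → ∀ M : ℕ, (∀ x, |f x| ≤ M) →
      Tendsto (fun n => ∫ x, f x ∂(p n).measure) 𝒰 (𝓝 (∫ x, f x ∂(μ : Measure X))) := by
    intro f hf M hM
    exact hlim' (BoundedContinuousFunction.ofNormedAddCommGroup f hf.continuous M hM)
  have hclose : ∀ c : ℝ, ∀ n : ℕ, (∀ m ≥ n, dist (p n) (p m) ≤ c) →
      ∀ f : X → ℝ, LipschitzWith 1 f → ∀ M : ℕ, (∀ x, |f x| ≤ M) →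
      |∫ x, f x ∂(p n).measure - ∫ x, f x ∂(μ : Measure X)| ≤ c := by
    intro c n hc f hf M hM
    refine le_of_tendsto ((tendsto_const_nhds.sub (hbd f hf M hM)).abs) ?_
    refine h𝒰 ?_
    filter_upwards [eventually_ge_atTop n] with m hm
    exact (abs_integral_sub_le (p n) (p m) hf).trans (hc m hm)
  -- finite first moment of the limit
  have hint : ∀ f : X → ℝ, LipschitzWith 1 f → Integrable f (μ : Measure X) := by
    intro f hf
    obtain ⟨N, hN⟩ := Metric.cauchySeq_iff'.1 hp 1 one_pos
    have hN' : ∀ m ≥ N, dist (p N) (p m) ≤ 1 := fun m hm => by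
      rw [dist_comm]; exact (hN m hm).le
    have hfa : LipschitzWith 1 fun x => |f x| := by
      refine LipschitzWith.of_dist_le_mul fun x y => ?_
      exact (abs_abs_sub_abs_le_abs_sub (f x) (f y)).trans (hf.dist_le_mul x y)
    have hB : ∀ M : ℕ, ∫ x, max (-(M : ℝ)) (min |f x| M) ∂(μ : Measure X)
        ≤ ∫ x, |f x| ∂(p N).measure + 1 := by
      intro M
      have h1 := hclose 1 N hN' _ (short_clamp hfa M) M fun x => abs_clamp_le _ _
      have h2 : ∫ x, max (-(M : ℝ)) (min |f x| M) ∂(p N).measure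
          ≤ ∫ x, |f x| ∂(p N).measure := by
        refine integral_mono ((p N).integrable _ (short_clamp hfa M)) ((p N).integrable _ hfa)
          fun x => ?_
        exact (le_abs_self _).trans ((abs_clamp_le_abs |f x| M).trans_eq (abs_abs _))
      linarith [(abs_le.1 h1).1]
    refine ⟨hf.continuous.aestronglyMeasurable, ?_⟩
    rw [hasFiniteIntegral_iff_norm]
    simp only [Real.norm_eq_abs]
    have hle : ∫⁻ x, ENNReal.ofReal |f x| ∂(μ : Measure X) ≤
        ENNReal.ofReal (∫ x, |f x| ∂(p N).measure + 1) := by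
      have hcont : ∀ M : ℕ, Continuous fun x => max (-(M : ℝ)) (min |f x| M) := fun M =>
        (short_clamp hfa M).continuous
      calc ∫⁻ x, ENNReal.ofReal |f x| ∂(μ : Measure X)
          = ∫⁻ x, liminf (fun M : ℕ => ENNReal.ofReal (max (-(M : ℝ)) (min |f x| M))) atTop
              ∂(μ : Measure X) := by
            refine lintegral_congr fun x => ?_
            exact ((ENNReal.tendsto_ofReal (tendsto_clamp |f x|)).liminf_eq).symm
        _ ≤ liminf (fun M : ℕ => ∫⁻ x, ENNReal.ofReal (max (-(M : ℝ)) (min |f x| M))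
              ∂(μ : Measure X)) atTop :=
            lintegral_liminf_le fun M => (hcont M).measurable.ennreal_ofReal
        _ ≤ _ := by
            refine liminf_le_of_frequently_le' (Frequently.of_forall fun M => ?_)
            rw [← ofReal_integral_eq_lintegral_ofReal]
            · exact ENNReal.ofReal_le_ofReal (hB M)
            · refine (integrable_const (M : ℝ)).mono' (hcont M).aestronglyMeasurable
                (Eventually.of_forall fun x => abs_clamp_le _ _)
            · refine Eventually.of_forall fun x => ?_
              exact le_max_of_le_right (le_min (abs_nonneg _) (Nat.cast_nonneg M))
    exact hle.trans_lt ENNReal.ofReal_lt_top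
  -- the limit is a Radon measure
  have hreg : (μ : Measure X).InnerRegular := by
    have hcl : IsClosed (closure (⋃ n, C n)) := isClosed_closure
    refine innerRegular_of_isSeparable hcl
      (TopologicalSpace.IsSeparable.iUnion fun n => (hC n).isSeparable).closure ?_
    have h1 : ∀ n, (μ : Measure X) (closure (⋃ n, C n))ᶜ ≤ u n := by
      intro n
      refine (measure_mono (compl_subset_compl.2
        ((subset_iUnion C n).trans subset_closure))).trans ?_
      rw [← ProbabilityMeasure.ennreal_coeFn_eq_coeFn_toMeasure, ENNReal.coe_le_coe]
      exact hμ n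
    have h2 : Tendsto (fun n => (u n : ℝ≥0∞)) atTop (𝓝 0) := by
      simpa using ENNReal.tendsto_coe.2 u_lim
    exact le_antisymm (ge_of_tendsto' h2 h1) zero_le
  let q : Kant X := ⟨μ, inferInstance, hreg, hint⟩
  refine ⟨q, Metric.tendsto_atTop.2 fun ε hε => ?_⟩
  obtain ⟨N, hN⟩ := Metric.cauchySeq_iff.1 hp (ε / 2) (half_pos hε)
  refine ⟨N, fun n hn => lt_of_le_of_lt (b := ε / 2) ?_ (half_lt_self hε)⟩
  refine dist_le_of_forall fun f hf => ?_
  have h1 := fun M : ℕ => hclose (ε / 2) n (fun m hm => (hN n hn m (le_trans hn hm)).le) _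
    (short_clamp hf M) M fun x => abs_clamp_le _ _
  exact le_of_tendsto' (((tendsto_integral_clamp hf.continuous ((p n).integrable f hf)).sub
    (tendsto_integral_clamp hf.continuous (hint f hf))).abs) h1

instance instCompleteSpace : CompleteSpace (Kant X) :=
  Metric.complete_of_cauchySeq_tendsto fun _ h => exists_limit h

end Complete

end Kant
namespace Kant

section Functor

variable {X Y : Type u} [MetricSpace X] [MeasurableSpace X] [BorelSpace X]
  [MetricSpace Y] [MeasurableSpace Y] [BorelSpace Y]

/-- The push-forward `f_* p` along a short map. -/
noncomputable def map (f : X → Y) (hf : LipschitzWith 1 f) (p : Kant X) : Kant Y where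
  measure := p.measure.map f
  isProb := Measure.isProbabilityMeasure_map hf.continuous.measurable.aemeasurable
  innerRegular := Measure.InnerRegular.map_of_continuous hf.continuous
  integrable g hg := by
    rw [integrable_map_measure hg.continuous.aestronglyMeasurable
      hf.continuous.measurable.aemeasurable]
    exact p.integrable _ (by rw [← one_mul (1 : ℝ≥0)]; exact hg.comp hf)

theorem integral_map {f : X → Y} (hf : LipschitzWith 1 f) (p : Kant X) {g : Y → ℝ}
    (hg : LipschitzWith 1 g) :
    ∫ y, g y ∂(map f hf p).measure = ∫ x, g (f x) ∂p.measure :=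
  MeasureTheory.integral_map hf.continuous.measurable.aemeasurable
    hg.continuous.aestronglyMeasurable

theorem short_map {f : X → Y} (hf : LipschitzWith 1 f) : LipschitzWith 1 (map f hf) := by
  refine LipschitzWith.of_dist_le_mul fun p q => ?_
  rw [NNReal.coe_one, one_mul]
  refine dist_le_of_forall fun g hg => ?_
  rw [integral_map hf p hg, integral_map hf q hg]
  exact abs_integral_sub_le p q (f := fun x => g (f x)) (by rw [← one_mul (1 : ℝ≥0)]; exact hg.comp hf)

end Functor

section Unit

variable {X : Type u} [MetricSpace X] [CompleteSpace X] [MeasurableSpace X] [BorelSpace X]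

/-- The Dirac measure `δ(x)`. -/
noncomputable def pure (x : X) : Kant X where
  measure := Measure.dirac x
  isProb := inferInstance
  innerRegular := innerRegular_of_isSeparable (A := {x}) isClosed_singleton
    (countable_singleton x).isSeparable (by simp)
  integrable f _ := integrable_dirac (by simp)

theorem integral_pure (x : X) (f : X → ℝ) : ∫ y, f y ∂(pure x).measure = f x :=
  integral_dirac f x

theorem short_pure : LipschitzWith 1 (pure : X → Kant X) := by
  refine LipschitzWith.of_dist_le_mul fun x y => dist_le_of_forall fun f hf => ?_
  rw [integral_pure, integral_pure]
  exact hf.dist_le_mul x y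

end Unit

section Mult

variable {X : Type u} [MetricSpace X] [CompleteSpace X] [MeasurableSpace X] [BorelSpace X]

theorem integrable_bind {X : Type u} [MetricSpace X] [MeasurableSpace X] [BorelSpace X] (μ : Kant (Kant X)) {f : X → ℝ} (hf : LipschitzWith 1 f) :
    Integrable f (μ.measure.bind Kant.measure) := by
  let κ : Kernel (Kant X) X := ⟨Kant.measure, measurable_measure⟩
  change Integrable f (μ.measure.bind κ)
  rw [Measure.integrable_comp_iff hf.continuous.aestronglyMeasurable]
  refine ⟨Eventually.of_forall fun p => p.integrable f hf, ?_⟩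
  have hfa : LipschitzWith 1 fun x => ‖f x‖ := by
    refine LipschitzWith.of_dist_le_mul fun x y => ?_
    exact (abs_abs_sub_abs_le_abs_sub (f x) (f y)).trans (hf.dist_le_mul x y)
  exact μ.integrable _ (short_integral hfa)

/-- The average `E μ`, that is, `(E μ)(A) = ∫ p(A) dμ(p)`. -/
noncomputable def join (μ : Kant (Kant X)) : Kant X where
  measure := μ.measure.bind Kant.measure
  isProb := isProbabilityMeasure_bind measurable_measure.aemeasurable
    (Eventually.of_forall fun p => p.isProb)
  innerRegular := by
    have hfin : IsProbabilityMeasure (μ.measure.bind Kant.measure) :=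
      isProbabilityMeasure_bind measurable_measure.aemeasurable
        (Eventually.of_forall fun p => p.isProb)
    obtain ⟨S, hS, hSs, hμS⟩ := exists_isSeparable μ
    obtain ⟨D, hD, hSD⟩ := hSs
    choose A hA hAs hA0 using fun p : Kant X => exists_isSeparable p
    have hsep : TopologicalSpace.IsSeparable (⋃ p ∈ D, A p) :=
      by
      have := hD.to_subtype
      rw [biUnion_eq_iUnion]
      exact TopologicalSpace.IsSeparable.iUnion fun p => hAs p
    refine innerRegular_of_isSeparable isClosed_closure hsep.closure ?_
    rw [Measure.bind_apply isClosed_closure.measurableSet.compl measurable_measure.aemeasurable]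
    refine lintegral_eq_zero_of_ae_eq_zero ?_
    refine measure_mono_null (compl_subset_compl.2 fun p hp => ?_) hμS
    have hsub : closure D ⊆ {p : Kant X | p.measure (closure (⋃ p ∈ D, A p))ᶜ = 0} :=
      closure_minimal (fun p hp => measure_mono_null (compl_subset_compl.2
        ((subset_biUnion_of_mem (u := A) hp).trans subset_closure)) (hA0 p))
        (isClosed_setOf_full isClosed_closure)
    simpa using hsub (hSD hp)
  integrable _ hf := integrable_bind μ hf

theorem integral_join (μ : Kant (Kant X)) {f : X → ℝ} (hf : LipschitzWith 1 f) :
    ∫ x, f x ∂(join μ).measure = ∫ p, ∫ x, f x ∂p.measure ∂μ.measure := by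
  let κ : Kernel (Kant X) X := ⟨Kant.measure, measurable_measure⟩
  have h : Integrable f (κ ∘ₘ μ.measure) := integrable_bind μ hf
  rw [Measure.comp_eq_comp_const_apply] at h
  have h2 := Kernel.integral_comp h
  rw [← Measure.comp_eq_comp_const_apply, Kernel.const_apply] at h2
  exact h2

theorem short_join : LipschitzWith 1 (join : Kant (Kant X) → Kant X) := by
  refine LipschitzWith.of_dist_le_mul fun μ ν => ?_
  rw [NNReal.coe_one, one_mul]
  refine dist_le_of_forall fun f hf => ?_
  rw [integral_join μ hf, integral_join ν hf]
  exact abs_integral_sub_le μ ν (short_integral hf)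

end Mult

end Kant
/-- The carrier of the tensor product `X ⊗ Y` of metric spaces: the set `X × Y` with the metric
`d((x, y), (x', y')) = d(x, x') + d(y, y')`. -/
@[ext]
structure L1Prod (X Y : Type u) where
  fst : X
  snd : Y

namespace L1Prod

variable {X Y : Type u} [MetricSpace X] [MetricSpace Y]

instance : MetricSpace (L1Prod X Y) where
  dist z w := dist z.fst w.fst + dist z.snd w.snd
  dist_self z := by simp
  dist_comm z w := by simp only [dist_comm]
  dist_triangle z w v := by
    linarith [dist_triangle z.fst w.fst v.fst, dist_triangle z.snd w.snd v.snd]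
  eq_of_dist_eq_zero {z w} h := by
    have h1 := dist_nonneg (x := z.fst) (y := w.fst)
    have h2 := dist_nonneg (x := z.snd) (y := w.snd)
    change dist z.fst w.fst + dist z.snd w.snd = 0 at h
    exact L1Prod.ext (dist_le_zero.1 (by linarith)) (dist_le_zero.1 (by linarith))

theorem dist_eq (z w : L1Prod X Y) : dist z w = dist z.fst w.fst + dist z.snd w.snd := rfl

instance [CompleteSpace X] [CompleteSpace Y] : CompleteSpace (L1Prod X Y) := by
  refine Metric.complete_of_cauchySeq_tendsto fun z hz => ?_
  have h1 : CauchySeq fun n => (z n).fst := Metric.cauchySeq_iff.2 fun ε hε => by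
    obtain ⟨N, hN⟩ := Metric.cauchySeq_iff.1 hz ε hε
    exact ⟨N, fun m hm n hn => lt_of_le_of_lt
      (le_add_of_nonneg_right dist_nonneg) (hN m hm n hn)⟩
  have h2 : CauchySeq fun n => (z n).snd := Metric.cauchySeq_iff.2 fun ε hε => by
    obtain ⟨N, hN⟩ := Metric.cauchySeq_iff.1 hz ε hε
    exact ⟨N, fun m hm n hn => lt_of_le_of_lt
      (le_add_of_nonneg_left dist_nonneg) (hN m hm n hn)⟩
  obtain ⟨x, hx⟩ := cauchySeq_tendsto_of_complete h1
  obtain ⟨y, hy⟩ := cauchySeq_tendsto_of_complete h2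
  refine ⟨⟨x, y⟩, tendsto_iff_dist_tendsto_zero.2 ?_⟩
  simpa [dist_eq] using
    (tendsto_iff_dist_tendsto_zero.1 hx).add (tendsto_iff_dist_tendsto_zero.1 hy)

end L1Prod

/-- Objects of the category of complete metric spaces and short maps. -/
structure CMet where
  carrier : Type u
  [metric : MetricSpace carrier]
  [complete : CompleteSpace carrier]

namespace CMet

instance : CoeSort CMet.{u} (Type u) := ⟨CMet.carrier⟩

attribute [instance] CMet.metric CMet.complete

/-- Every complete metric space carries its Borel σ-algebra. -/
instance (X : CMet.{u}) : MeasurableSpace X := borel X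

instance (X : CMet.{u}) : BorelSpace X := ⟨rfl⟩

/-- Short maps. -/
@[ext]
structure Hom (X Y : CMet.{u}) where
  toFun : X → Y
  short : LipschitzWith 1 toFun

instance : Category CMet.{u} where
  Hom X Y := Hom X Y
  id X := ⟨id, LipschitzWith.id⟩
  comp f g := ⟨g.toFun ∘ f.toFun, by rw [← one_mul (1 : ℝ≥0)]; exact g.short.comp f.short⟩

@[ext]
theorem hom_ext {X Y : CMet.{u}} {f g : X ⟶ Y} (h : ∀ x, f.toFun x = g.toFun x) : f = g :=
  Hom.ext (funext h)

@[simp]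
theorem id_toFun {X : CMet.{u}} (x : X) : (𝟙 X : X ⟶ X).toFun x = x := rfl

@[simp]
theorem comp_toFun {X Y Z : CMet.{u}} (f : X ⟶ Y) (g : Y ⟶ Z) (x : X) :
    (f ≫ g).toFun x = g.toFun (f.toFun x) := rfl

theorem dist_toFun_le {X Y : CMet.{u}} (f : X ⟶ Y) (x x' : X) :
    dist (f.toFun x) (f.toFun x') ≤ dist x x' := by
  simpa using f.short.dist_le_mul x x'

/-- A short map from a pointwise inequality. -/
def mkHom {X Y : CMet.{u}} (f : X → Y) (h : ∀ x x', dist (f x) (f x') ≤ dist x x') : X ⟶ Y :=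
  ⟨f, LipschitzWith.of_dist_le_mul fun x x' => by simpa using h x x'⟩

/-- The tensor product `X ⊗ Y`, with the sum metric. -/
abbrev tensor (X Y : CMet.{u}) : CMet.{u} := ⟨L1Prod X Y⟩

/-- `f ⊗ g : (x, y) ↦ (f x, g y)`. -/
def tensorMap {X X' Y Y' : CMet.{u}} (f : X ⟶ X') (g : Y ⟶ Y') : tensor X Y ⟶ tensor X' Y' :=
  mkHom (fun z => ⟨f.toFun z.fst, g.toFun z.snd⟩) fun _ _ =>
    add_le_add (dist_toFun_le f _ _) (dist_toFun_le g _ _)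

/-- `((x, y), z) ↦ (x, (y, z))`. -/
def assocIso (X Y Z : CMet.{u}) : tensor (tensor X Y) Z ≅ tensor X (tensor Y Z) where
  hom := mkHom (fun v => ⟨v.fst.fst, ⟨v.fst.snd, v.snd⟩⟩) fun v w => by
    simp only [L1Prod.dist_eq]; linarith
  inv := mkHom (fun v => ⟨⟨v.fst, v.snd.fst⟩, v.snd.snd⟩) fun v w => by
    simp only [L1Prod.dist_eq]; linarith

/-- `(*, x) ↦ x`. -/
def leftIso (X : CMet.{u}) : tensor ⟨PUnit.{u + 1}⟩ X ≅ X where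
  hom := mkHom (fun v => v.snd) fun _ _ => le_add_of_nonneg_left dist_nonneg
  inv := mkHom (fun x => ⟨PUnit.unit, x⟩) fun _ _ => by simp [L1Prod.dist_eq]

/-- `(x, *) ↦ x`. -/
def rightIso (X : CMet.{u}) : tensor X ⟨PUnit.{u + 1}⟩ ≅ X where
  hom := mkHom (fun v => v.fst) fun _ _ => le_add_of_nonneg_right dist_nonneg
  inv := mkHom (fun x => ⟨x, PUnit.unit⟩) fun _ _ => by simp [L1Prod.dist_eq]

/-- `(x, y) ↦ (y, x)`. -/
def swapIso (X Y : CMet.{u}) : tensor X Y ≅ tensor Y X where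
  hom := mkHom (fun v => ⟨v.snd, v.fst⟩) fun v w => by
    simp only [L1Prod.dist_eq]; linarith
  inv := mkHom (fun v => ⟨v.snd, v.fst⟩) fun v w => by
    simp only [L1Prod.dist_eq]; linarith

instance : MonoidalCategory CMet.{u} where
  tensorObj X Y := tensor X Y
  tensorUnit := ⟨PUnit.{u + 1}⟩
  tensorHom f g := tensorMap f g
  whiskerLeft X _ _ f := tensorMap (𝟙 X) f
  whiskerRight f Y := tensorMap f (𝟙 Y)
  associator := assocIso
  leftUnitor := leftIso
  rightUnitor := rightIso
  tensorHom_def _ _ := rfl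
  id_tensorHom_id _ _ := rfl
  tensorHom_comp_tensorHom _ _ _ _ := rfl
  whiskerLeft_id _ _ := rfl
  id_whiskerRight _ _ := rfl
  associator_naturality _ _ _ := rfl
  leftUnitor_naturality _ := rfl
  rightUnitor_naturality _ := rfl
  pentagon _ _ _ _ := rfl
  triangle _ _ := rfl

instance : SymmetricCategory CMet.{u} where
  braiding := swapIso
  braiding_naturality_right _ _ _ _ := rfl
  braiding_naturality_left _ _ := rfl
  hexagon_forward _ _ _ := rfl
  hexagon_reverse _ _ _ := rfl
  symmetry _ _ := rfl

end CMet

namespace CMet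

/-- The complete metric space `PX`. -/
noncomputable abbrev P (X : CMet.{u}) : CMet.{u} := ⟨Kant X⟩

/-- `Pf : p ↦ f_* p`. -/
noncomputable def push {X Y : CMet.{u}} (f : X ⟶ Y) : P X ⟶ P Y :=
  ⟨Kant.map f.toFun f.short, Kant.short_map f.short⟩

/-- `δ : x ↦ δ(x)`, the Dirac measure. -/
noncomputable def dirac (X : CMet.{u}) : X ⟶ P X :=
  ⟨Kant.pure, Kant.short_pure⟩

/-- `E : μ ↦ Eμ`, the average. -/
noncomputable def average (X : CMet.{u}) : P (P X) ⟶ P X :=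
  ⟨Kant.join (X := X), Kant.short_join (X := X)⟩

theorem short_comp {X Y : CMet.{u}} (g : X ⟶ Y) {f : Y → ℝ} (hf : LipschitzWith 1 f) :
    LipschitzWith 1 fun x => f (g.toFun x) := by
  rw [← one_mul (1 : ℝ≥0)]; exact hf.comp g.short

theorem hom_ext_P {X Y : CMet.{u}} {g h : X ⟶ P Y}
    (H : ∀ (x : X) (f : Y → ℝ), LipschitzWith 1 f →
      ∫ y, f y ∂(g.toFun x : Kant Y).measure = ∫ y, f y ∂(h.toFun x : Kant Y).measure) : g = h :=
  hom_ext fun x => Kant.ext_of_integral (H x)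

/-- `∫ f d(g_* p) = ∫ f ∘ g dp`. -/
theorem integral_push {X Y : CMet.{u}} (g : X ⟶ Y) (p : Kant X) {f : Y → ℝ}
    (hf : LipschitzWith 1 f) :
    ∫ y, f y ∂((push g).toFun p : Kant Y).measure = ∫ x, f (g.toFun x) ∂p.measure :=
  Kant.integral_map g.short p hf

/-- `∫ f d(δ(x)) = f(x)`. -/
theorem integral_dirac {X : CMet.{u}} (x : X) (f : X → ℝ) :
    ∫ y, f y ∂((dirac X).toFun x : Kant X).measure = f x :=
  Kant.integral_pure x f

/-- `∫ f d(Eμ) = ∫ (∫ f dp) dμ(p)`. -/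
theorem integral_average {X : CMet.{u}} (μ : Kant (P X)) {f : X → ℝ}
    (hf : LipschitzWith 1 f) :
    ∫ y, f y ∂((average X).toFun μ : Kant X).measure
      = ∫ p : Kant X, ∫ y, f y ∂p.measure ∂μ.measure :=
  Kant.integral_join μ hf

theorem short_int {X : CMet.{u}} {f : X → ℝ} (hf : LipschitzWith 1 f) :
    LipschitzWith 1 fun p : P X => ∫ y, f y ∂(p : Kant X).measure :=
  Kant.short_integral hf

/-- The Kantorovich monad `(P, δ, E)`: on objects `X ↦ PX`, on morphisms the push-forward, with
unit `δ` given by Dirac measures and multiplication `E` given by averaging. -/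
noncomputable def kantorovichMonad : Monad CMet.{u} where
  obj X := P X
  map f := push f
  map_id X := hom_ext_P fun p f hf => integral_push (𝟙 X) p hf
  map_comp g h := hom_ext_P fun p f hf => by
    rw [integral_push _ _ hf, comp_toFun, integral_push _ _ hf,
      integral_push _ _ (short_comp h hf)]
    rfl
  η :=
    { app := dirac
      naturality := fun X Y g => hom_ext_P fun x f hf => by
        change ∫ y, f y ∂((dirac Y).toFun (g.toFun x)).measure
          = ∫ y, f y ∂((push g).toFun ((dirac X).toFun x)).measure
        rw [integral_push _ _ hf, integral_dirac]
        exact (integral_dirac (X := X) x fun x => f (g.toFun x)).symm }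
  μ :=
    { app := average
      naturality := fun X Y g => hom_ext_P fun μ f hf => by
        change ∫ y, f y ∂((average Y).toFun ((push (push g)).toFun μ)).measure
          = ∫ y, f y ∂((push g).toFun ((average X).toFun μ)).measure
        rw [integral_push _ _ hf, integral_average _ hf, integral_average _ (short_comp g hf),
          integral_push _ _ (short_int hf)]
        exact integral_congr_ae (Eventually.of_forall fun p => integral_push g p hf) }
  assoc X := hom_ext_P fun μ f hf => by
    change ∫ y, f y ∂((average X).toFun ((push (average X)).toFun μ)).measure
      = ∫ y, f y ∂((average X).toFun ((average (P X)).toFun μ)).measure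
    rw [integral_average _ hf, integral_average _ hf, integral_push _ _ (short_int hf),
      integral_average _ (short_int hf)]
    exact integral_congr_ae (Eventually.of_forall fun p => integral_average p hf)
  left_unit X := hom_ext_P fun p f hf => by
    change ∫ y, f y ∂((average X).toFun ((dirac (P X)).toFun p)).measure = ∫ y, f y ∂p.measure
    rw [integral_average _ hf]
    exact integral_dirac (X := P X) p _
  right_unit X := hom_ext_P fun p f hf => by
    change ∫ y, f y ∂((average X).toFun ((push (dirac X)).toFun p)).measure = ∫ y, f y ∂p.measure
    rw [integral_average _ hf, integral_push _ _ (short_int hf)]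
    exact integral_congr_ae (Eventually.of_forall fun x => integral_dirac x f)

end CMet

section Bimonoidal

open Functor.LaxMonoidal Functor.OplaxMonoidal

/-- Symmetric (braided) bilax monoidal structures on a functor between symmetric monoidal
categories: a lax structure with unit `ε : 𝟙 ⟶ F 𝟙` and multiplication `μ : FX ⊗ FY ⟶ F (X ⊗ Y)`
(often written `∇`), an oplax structure with counit `η : F 𝟙 ⟶ 𝟙` and comultiplication
`δ : F (X ⊗ Y) ⟶ FX ⊗ FY` (often written `Δ`), both compatible with the braidings, subject to the
bimonoidality diagram and the three unit/counit diagrams. -/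
class SymmetricBilaxMonoidal {C D : Type*} [Category C] [MonoidalCategory C] [SymmetricCategory C]
    [Category D] [MonoidalCategory D] [SymmetricCategory D] (F : C ⥤ D) extends
    F.LaxMonoidal, F.OplaxMonoidal where
  /-- the multiplication commutes with the braiding -/
  braided : ∀ X Y : C, μ X Y ≫ F.map (β_ X Y).hom = (β_ (F.obj X) (F.obj Y)).hom ≫ μ Y X
  /-- the comultiplication commutes with the braiding -/
  cobraided : ∀ X Y : C, F.map (β_ X Y).hom ≫ δ Y X = δ X Y ≫ (β_ (F.obj X) (F.obj Y)).hom
  /-- the bimonoidality (distributivity) diagram; `tensorμ` swaps the two middle factors -/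
  bimonoidality : ∀ W X Y Z : C,
    μ (W ⊗ X) (Y ⊗ Z) ≫ F.map (tensorμ W X Y Z) ≫ δ (W ⊗ Y) (X ⊗ Z) =
      (δ W X ⊗ₘ δ Y Z) ≫ tensorμ (F.obj W) (F.obj X) (F.obj Y) (F.obj Z) ≫ (μ W Y ⊗ₘ μ X Z)
  /-- the unit followed by the counit is the identity -/
  unit_counit : ε ≫ η = 𝟙 (𝟙_ D)
  /-- the unit is compatible with the comultiplication -/
  unit_comul : ε ≫ F.map (λ_ (𝟙_ C)).inv ≫ δ (𝟙_ C) (𝟙_ C) = (λ_ (𝟙_ D)).inv ≫ (ε ⊗ₘ ε)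
  /-- the counit is compatible with the multiplication -/
  mul_counit : μ (𝟙_ C) (𝟙_ C) ≫ F.map (λ_ (𝟙_ C)).hom ≫ η = (η ⊗ₘ η) ≫ (λ_ (𝟙_ D)).hom

/-- Oplax monoidal natural transformations. -/
structure IsOplaxMonoidalNatTrans {C D : Type*} [Category C] [MonoidalCategory C]
    [Category D] [MonoidalCategory D] {F G : C ⥤ D} [F.OplaxMonoidal] [G.OplaxMonoidal]
    (τ : F ⟶ G) : Prop where
  counit : τ.app (𝟙_ C) ≫ η G = η F
  comul : ∀ X Y : C, τ.app (X ⊗ Y) ≫ δ G X Y = δ F X Y ≫ (τ.app X ⊗ₘ τ.app Y)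

/-- Bilax monoidal natural transformations: both lax and oplax monoidal. -/
structure IsBilaxMonoidalNatTrans {C D : Type*} [Category C] [MonoidalCategory C]
    [Category D] [MonoidalCategory D] {F G : C ⥤ D} [F.LaxMonoidal] [F.OplaxMonoidal]
    [G.LaxMonoidal] [G.OplaxMonoidal] (τ : F ⟶ G) : Prop where
  lax : NatTrans.IsMonoidal τ
  oplax : IsOplaxMonoidalNatTrans τ

/-- A symmetric bimonoidal monad structure on a monad `T`: a symmetric bilax monoidal structure
on its functor for which the unit `𝟭 ⟶ T` and the multiplication `T ⋙ T ⟶ T` are bilax monoidal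
natural transformations; `𝟭` and `T ⋙ T` carry the identity and the composite structures. -/
class SymmetricBimonoidalMonad {C : Type*} [Category C] [MonoidalCategory C] [SymmetricCategory C]
    (T : Monad C) extends SymmetricBilaxMonoidal T.toFunctor where
  unit_bilax : IsBilaxMonoidalNatTrans T.η
  mul_bilax : IsBilaxMonoidalNatTrans T.μ

end Bimonoidal

namespace CMet

/-- `r` is the product joint `p ⊗_∇ q`: for every short `f : X ⊗ Y → ℝ`, its integral against `r`
is the iterated integral `∫∫ f(x, y) dp(x) dq(y)` (in either order). -/
def IsProductJoint {X Y : CMet.{u}} (p : P X) (q : P Y) (r : P (X ⊗ Y)) : Prop :=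
  ∀ f : L1Prod X Y → ℝ, LipschitzWith 1 f →
    ∫ z, f z ∂(Kant.measure r) = ∫ x, ∫ y, f ⟨x, y⟩ ∂(Kant.measure q) ∂(Kant.measure p) ∧
    ∫ z, f z ∂(Kant.measure r) = ∫ y, ∫ x, f ⟨x, y⟩ ∂(Kant.measure p) ∂(Kant.measure q)

/-- `(p, q)` is the pair of marginals `(r_X, r_Y)` of `r`: integrals against `p` and `q` are
integrals against `r` of functions of the first and of the second coordinate. -/
def IsPairOfMarginals {X Y : CMet.{u}} (r : P (X ⊗ Y)) (p : P X) (q : P Y) : Prop :=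
  (∀ f : X → ℝ, LipschitzWith 1 f →
    ∫ x, f x ∂(Kant.measure p) = ∫ z : L1Prod X Y, f z.fst ∂(Kant.measure r)) ∧
  (∀ g : Y → ℝ, LipschitzWith 1 g →
    ∫ y, g y ∂(Kant.measure q) = ∫ z : L1Prod X Y, g z.snd ∂(Kant.measure r))

end CMet

/-!
A law on a metric space is determined by its integrals of short maps (`Kant.ext_of_integral`), so
every diagram ending in some `PX` is checked on those.

The product joint `∇(p, q)` is built without a product measure: `X` and `Y` need not be second
countable, so the Borel σ-algebra of `X ⊗ Y` may be larger than the product σ-algebra. Instead,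
for fixed `q` the short map `x ↦ δ(x) ⊗ q` from `X` to `P(X ⊗ Y)` is pushed forward along `p` and
averaged. This gives `∫ f d∇(p, q) = ∫ x, ∫ y, f(x, y) dq dp` by construction
(`CMet.integral_joint`). The one analytic input is Fubini's theorem for short functions
(`Kant.integral_integral_swap`): Radon measures live on closed separable subsets, over which the
two σ-algebras agree. It yields the shortness of `∇` in its second argument, the symmetry of `∇`,
and the compatibility of `∇` with averages.

The marginal map `Δ = (P(fst), P(snd))` is short for the sum metric because `f(x) + g(y)` is short
on `X ⊗ Y` when `f` and `g` are (`Kant.dist_map_fst_add_dist_map_snd_le`). As `Δ` is made of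
push-forwards along the two projections, all diagrams ending in a tensor product `PX ⊗ PY` are
checked on the two components, where they become instances of functoriality or naturality. In
particular, bimonoidality is the naturality of `∇` with respect to projections
(`CMet.joint_marginals_bimonoidality`).
-/

/-! ### The sum metric on a product -/

namespace L1Prod

variable {X Y : Type u} [MetricSpace X] [MetricSpace Y]

theorem lipschitzWith_mk_right (x : X) : LipschitzWith 1 fun y : Y => (⟨x, y⟩ : L1Prod X Y) :=
  LipschitzWith.of_dist_le_mul fun y y' => by simp [dist_eq]

theorem lipschitzWith_mk_left (y : Y) : LipschitzWith 1 fun x : X => (⟨x, y⟩ : L1Prod X Y) :=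
  LipschitzWith.of_dist_le_mul fun x x' => by simp [dist_eq]

theorem lipschitzWith_fst : LipschitzWith 1 (L1Prod.fst : L1Prod X Y → X) :=
  LipschitzWith.of_dist_le_mul fun z w => by
    simp [dist_eq]

theorem lipschitzWith_snd : LipschitzWith 1 (L1Prod.snd : L1Prod X Y → Y) :=
  LipschitzWith.of_dist_le_mul fun z w => by
    simp [dist_eq]

theorem continuous_mk : Continuous fun z : X × Y => (⟨z.1, z.2⟩ : L1Prod X Y) := by
  refine (LipschitzWith.of_dist_le_mul (K := 2) fun z w => ?_).continuous
  have h1 : dist z.1 w.1 ≤ dist z w := le_max_left _ _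
  have h2 : dist z.2 w.2 ≤ dist z w := le_max_right _ _
  rw [dist_eq, NNReal.coe_ofNat]
  linarith

end L1Prod

theorem LipschitzWith.comp_short {X Y Z : Type*} [PseudoEMetricSpace X] [PseudoEMetricSpace Y]
    [PseudoEMetricSpace Z] {f : Y → Z} {g : X → Y} (hf : LipschitzWith 1 f)
    (hg : LipschitzWith 1 g) : LipschitzWith 1 fun x => f (g x) := by
  rw [← one_mul (1 : ℝ≥0)]
  exact hf.comp hg

/-! ### Iterated integrals and marginals -/

namespace Kant

variable {X Y : Type u} [MetricSpace X] [MeasurableSpace X] [BorelSpace X]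
  [MetricSpace Y] [MeasurableSpace Y] [BorelSpace Y]

/-- Fubini's theorem for short functions. Both measures are concentrated on closed separable
subsets, on whose product the continuous integrand is measurable for the product σ-algebra. -/
theorem integral_integral_swap (p : Kant X) (q : Kant Y) {f : L1Prod X Y → ℝ}
    (hf : LipschitzWith 1 f) :
    ∫ x, ∫ y, f ⟨x, y⟩ ∂q.measure ∂p.measure = ∫ y, ∫ x, f ⟨x, y⟩ ∂p.measure ∂q.measure := by
  obtain ⟨A, hA, hAs, hA0⟩ := exists_isSeparable p
  obtain ⟨B, hB, hBs, hB0⟩ := exists_isSeparable q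
  have : TopologicalSpace.SeparableSpace A := hAs.separableSpace
  have : SecondCountableTopology A := UniformSpace.secondCountable_of_separable A
  have : TopologicalSpace.SeparableSpace B := hBs.separableSpace
  have : SecondCountableTopology B := UniformSpace.secondCountable_of_separable B
  have eA := MeasurableEmbedding.subtype_coe hA.measurableSet
  have eB := MeasurableEmbedding.subtype_coe hB.measurableSet
  set p' := p.measure.comap (Subtype.val : A → X) with hp'
  set q' := q.measure.comap (Subtype.val : B → Y) with hq'
  have : IsFiniteMeasure p' := by rw [hp']; infer_instance
  have : IsFiniteMeasure q' := by rw [hq']; infer_instance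
  have hp : p'.map Subtype.val = p.measure := by
    rw [hp', eA.map_comap, Subtype.range_coe]
    exact Measure.restrict_eq_self_of_ae_mem hA0
  have hq : q'.map Subtype.val = q.measure := by
    rw [hq', eB.map_comap, Subtype.range_coe]
    exact Measure.restrict_eq_self_of_ae_mem hB0
  obtain ⟨x₀⟩ : Nonempty X := p.measure.nonempty_of_neZero
  obtain ⟨y₀⟩ : Nonempty Y := q.measure.nonempty_of_neZero
  have hip : Integrable (fun a : A => dist (a : X) x₀) p' := by
    have := p.integrable _ (LipschitzWith.dist_left x₀)
    rwa [← hp, eA.integrable_map_iff] at this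
  have hiq : Integrable (fun b : B => dist (b : Y) y₀) q' := by
    have := q.integrable _ (LipschitzWith.dist_left y₀)
    rwa [← hq, eB.integrable_map_iff] at this
  have hint : Integrable (Function.uncurry fun (a : A) (b : B) => f ⟨a, b⟩) (p'.prod q') := by
    -- a short function grows at most linearly, and the laws have finite first moments
    refine Integrable.mono' (g := fun z => |f ⟨x₀, y₀⟩| + (dist (z.1 : X) x₀ + dist (z.2 : Y) y₀))
      ((integrable_const _).add ((hip.comp_fst q').add (hiq.comp_snd p'))) ?_
      (Eventually.of_forall fun z => ?_)
    · exact (hf.continuous.comp (L1Prod.continuous_mk.comp (continuous_subtype_val.prodMap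
        continuous_subtype_val))).aestronglyMeasurable
    · have h1 := hf.dist_le_mul ⟨z.1, z.2⟩ ⟨x₀, y₀⟩
      rw [L1Prod.dist_eq, NNReal.coe_one, one_mul, Real.dist_eq] at h1
      have h2 := abs_sub_abs_le_abs_sub (f ⟨z.1, z.2⟩) (f ⟨x₀, y₀⟩)
      rw [Real.norm_eq_abs]
      simp only [Function.uncurry]
      linarith
  rw [← hp, ← hq]
  simp only [eA.integral_map, eB.integral_map]
  exact MeasureTheory.integral_integral_swap hint

theorem short_integral_right {X Y : Type u} [MetricSpace X] [MetricSpace Y] [MeasurableSpace Y]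
    [BorelSpace Y] (q : Kant Y) {f : L1Prod X Y → ℝ} (hf : LipschitzWith 1 f) :
    LipschitzWith 1 fun x => ∫ y, f ⟨x, y⟩ ∂q.measure := by
  have hi : ∀ x, Integrable (fun y => f ⟨x, y⟩) q.measure := fun x =>
    q.integrable _ (hf.comp_short (L1Prod.lipschitzWith_mk_right x))
  refine LipschitzWith.of_dist_le_mul fun x x' => ?_
  rw [Real.dist_eq, ← integral_sub (hi x) (hi x'), NNReal.coe_one, one_mul, ← Real.norm_eq_abs]
  refine (norm_integral_le_of_norm_le_const (C := dist x x') (Eventually.of_forall fun y => ?_)).trans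
    (by simp)
  simpa [L1Prod.dist_eq, Real.dist_eq] using hf.dist_le_mul ⟨x, y⟩ ⟨x', y⟩

theorem short_integral_left {X Y : Type u} [MetricSpace X] [MeasurableSpace X] [BorelSpace X]
    [MetricSpace Y] (p : Kant X) {f : L1Prod X Y → ℝ} (hf : LipschitzWith 1 f) :
    LipschitzWith 1 fun y => ∫ x, f ⟨x, y⟩ ∂p.measure :=
  p.short_integral_right (f := fun z => f ⟨z.snd, z.fst⟩)
    (hf.comp_short (LipschitzWith.of_dist_le_mul fun z w => by simp [L1Prod.dist_eq, add_comm]))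

/-- Taking marginals is short for the sum metric: the test functions for the two marginals add up
to a single one, since `(x, y) ↦ f x + g y` is short on `L1Prod X Y` when `f` and `g` are. -/
theorem dist_map_fst_add_dist_map_snd_le [MeasurableSpace (L1Prod X Y)] [BorelSpace (L1Prod X Y)]
    (r s : Kant (L1Prod X Y)) :
    dist (map L1Prod.fst L1Prod.lipschitzWith_fst r) (map L1Prod.fst L1Prod.lipschitzWith_fst s)
      + dist (map L1Prod.snd L1Prod.lipschitzWith_snd r)
        (map L1Prod.snd L1Prod.lipschitzWith_snd s) ≤ dist r s := by
  have key : ∀ (f : X → ℝ) (g : Y → ℝ), LipschitzWith 1 f → LipschitzWith 1 g →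
      (∫ z, f z.fst ∂r.measure - ∫ z, f z.fst ∂s.measure)
      + (∫ z, g z.snd ∂r.measure - ∫ z, g z.snd ∂s.measure) ≤ dist r s := by
    intro f g hf hg
    have h1 := hf.comp_short (L1Prod.lipschitzWith_fst (X := X) (Y := Y))
    have h2 := hg.comp_short (L1Prod.lipschitzWith_snd (X := X) (Y := Y))
    have hfg : LipschitzWith 1 fun z : L1Prod X Y => f z.fst + g z.snd :=
      LipschitzWith.of_dist_le_mul fun z w => by
        have hf' := hf.dist_le_mul z.fst w.fst
        have hg' := hg.dist_le_mul z.snd w.snd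
        rw [NNReal.coe_one, one_mul] at hf' hg' ⊢
        exact (dist_add_add_le _ _ _ _).trans (add_le_add hf' hg')
    have h := abs_integral_sub_le r s hfg
    rw [integral_add (r.integrable _ h1) (r.integrable _ h2),
      integral_add (s.integrable _ h1) (s.integrable _ h2)] at h
    linarith [(abs_le.1 h).2]
  rw [← le_sub_iff_add_le]
  refine dist_le_of_forall fun f hf => ?_
  rw [le_sub_comm]
  refine dist_le_of_forall fun g hg => ?_
  rw [le_sub_comm, integral_map _ r hf, integral_map _ s hf, integral_map _ r hg,
    integral_map _ s hg, le_sub_iff_add_le]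
  -- `f` and `g` may be replaced by their negatives, so both absolute values are attained
  have k1 := key f g hf hg
  have k2 := key (fun x => -f x) g hf.neg hg
  have k3 := key f (fun y => -g y) hf hg.neg
  have k4 := key (fun x => -f x) (fun y => -g y) hf.neg hg.neg
  simp only [integral_neg] at k2 k3 k4
  rcases abs_cases (∫ z, f z.fst ∂r.measure - ∫ z, f z.fst ∂s.measure) with ⟨h1, -⟩ | ⟨h1, -⟩ <;>
    rcases abs_cases (∫ z, g z.snd ∂r.measure - ∫ z, g z.snd ∂s.measure)
      with ⟨h2, -⟩ | ⟨h2, -⟩ <;>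
    linarith

end Kant

/-! ### The structure maps `∇` and `Δ` -/

namespace CMet

/-- The slice `y ↦ (x, y)`. -/
def slice {X : CMet.{u}} (Y : CMet.{u}) (x : X) : Y ⟶ X ⊗ Y :=
  ⟨_, L1Prod.lipschitzWith_mk_right x⟩

theorem integral_push_slice {X Y : CMet.{u}} (x : X) (q : P Y) {f : L1Prod X Y → ℝ}
    (hf : LipschitzWith 1 f) :
    ∫ z, f z ∂(Kant.measure ((push (slice Y x)).toFun q)) = ∫ y, f ⟨x, y⟩ ∂(Kant.measure q) :=
  integral_push (slice Y x) q hf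

/-- The strength with fixed second argument: `x ↦ δ(x) ⊗ q`. -/
noncomputable def jointDirac (X : CMet.{u}) {Y : CMet.{u}} (q : P Y) : X ⟶ P (X ⊗ Y) :=
  mkHom (fun x => (push (slice Y x)).toFun q) fun x x' =>
    Kant.dist_le_of_forall fun f hf => by
      rw [integral_push_slice x q hf, integral_push_slice x' q hf]
      simpa [Real.dist_eq] using (Kant.short_integral_right q hf).dist_le_mul x x'

/-- The product joint of `p` and `q`: the average of the laws `δ(x) ⊗ q` for `x` distributed
according to `p`. -/
noncomputable def productJoint {X Y : CMet.{u}} (p : P X) (q : P Y) : P (X ⊗ Y) :=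
  (average (X ⊗ Y)).toFun ((push (jointDirac X q)).toFun p)

theorem integral_productJoint {X Y : CMet.{u}} (p : P X) (q : P Y) {f : L1Prod X Y → ℝ}
    (hf : LipschitzWith 1 f) :
    ∫ z, f z ∂(Kant.measure (productJoint p q))
      = ∫ x, ∫ y, f ⟨x, y⟩ ∂(Kant.measure q) ∂(Kant.measure p) := by
  refine (integral_average (X := X ⊗ Y) _ hf).trans ?_
  refine (integral_push (jointDirac X q) p (short_int (X := X ⊗ Y) hf)).trans ?_
  exact integral_congr_ae (Eventually.of_forall fun x => integral_push_slice x q hf)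

theorem dist_productJoint_le {X Y : CMet.{u}} (p p' : P X) (q q' : P Y) :
    dist (productJoint p q) (productJoint p' q') ≤ dist p p' + dist q q' := by
  refine Kant.dist_le_of_forall fun f hf => ?_
  rw [integral_productJoint p q hf, integral_productJoint p' q' hf]
  refine (abs_sub_le _ (∫ x, ∫ y, f ⟨x, y⟩ ∂(Kant.measure q) ∂(Kant.measure p')) _).trans
    (add_le_add ?_ ?_)
  · exact Kant.abs_integral_sub_le p p' (Kant.short_integral_right q hf)
  -- with `y` as the outer variable, the inner integral against `p'` is a common test function
  · rw [Kant.integral_integral_swap p' q hf, Kant.integral_integral_swap p' q' hf]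
    exact Kant.abs_integral_sub_le q q' (Kant.short_integral_left p' hf)

/-- The multiplication `∇ : PX ⊗ PY ⟶ P(X ⊗ Y)`, sending a pair of laws to its product joint. -/
noncomputable def joint (X Y : CMet.{u}) : P X ⊗ P Y ⟶ P (X ⊗ Y) :=
  mkHom (fun z => productJoint z.fst z.snd) fun _ _ => dist_productJoint_le _ _ _ _

theorem integral_joint {X Y : CMet.{u}} (z : L1Prod (P X) (P Y)) {f : L1Prod X Y → ℝ}
    (hf : LipschitzWith 1 f) :
    ∫ w, f w ∂(Kant.measure ((joint X Y).toFun z))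
      = ∫ x, ∫ y, f ⟨x, y⟩ ∂(Kant.measure z.snd) ∂(Kant.measure z.fst) :=
  integral_productJoint z.fst z.snd hf

/-- The first projection. -/
def proj₁ (X Y : CMet.{u}) : X ⊗ Y ⟶ X := ⟨_, L1Prod.lipschitzWith_fst⟩

/-- The second projection. -/
def proj₂ (X Y : CMet.{u}) : X ⊗ Y ⟶ Y := ⟨_, L1Prod.lipschitzWith_snd⟩

/-- The comultiplication `Δ : P(X ⊗ Y) ⟶ PX ⊗ PY`, sending a law to its pair of marginals. -/
noncomputable def marginals (X Y : CMet.{u}) : P (X ⊗ Y) ⟶ P X ⊗ P Y :=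
  mkHom (fun r => ⟨(push (proj₁ X Y)).toFun r, (push (proj₂ X Y)).toFun r⟩) fun r s =>
    -- the Borel structure of `X ⊗ Y`, restated for its carrier `L1Prod X Y`
    letI : MeasurableSpace (L1Prod X Y) := borel _
    haveI : BorelSpace (L1Prod X Y) := ⟨rfl⟩
    Kant.dist_map_fst_add_dist_map_snd_le (X := X) (Y := Y) r s

/-! ### Coherence of the product joint -/

theorem joint_natural {X X' Y Y' : CMet.{u}} (g : X ⟶ X') (h : Y ⟶ Y') :
    (push g ⊗ₘ push h) ≫ joint X' Y' = joint X Y ≫ push (g ⊗ₘ h) :=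
  hom_ext_P fun z f hf => by
    have hf' := short_comp (g ⊗ₘ h) hf
    refine (integral_joint _ hf).trans (Eq.trans ?_
      ((integral_push (g ⊗ₘ h) _ hf).trans (integral_joint z hf')).symm)
    refine (integral_push g z.fst (Kant.short_integral_right _ hf)).trans ?_
    exact integral_congr_ae (Eventually.of_forall fun x =>
      integral_push h z.snd (hf.comp_short (L1Prod.lipschitzWith_mk_right (g.toFun x))))

theorem joint_associativity (X Y Z : CMet.{u}) :
    (joint X Y ⊗ₘ 𝟙 (P Z)) ≫ joint (X ⊗ Y) Z ≫ push (α_ X Y Z).hom =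
      (α_ (P X) (P Y) (P Z)).hom ≫ (𝟙 (P X) ⊗ₘ joint Y Z) ≫ joint X (Y ⊗ Z) :=
  hom_ext_P fun z f hf => by
    have hf' := short_comp (α_ X Y Z).hom hf
    refine (integral_push (α_ X Y Z).hom _ hf).trans ((integral_joint _ hf').trans ?_)
    refine (integral_joint z.fst (Kant.short_integral_right z.snd hf')).trans ?_
    refine Eq.trans ?_ (integral_joint _ hf).symm
    exact integral_congr_ae (Eventually.of_forall fun x =>
      (integral_joint (X := Y) (Y := Z) ⟨z.fst.snd, z.snd⟩
        (hf.comp_short (L1Prod.lipschitzWith_mk_right x))).symm)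

theorem joint_left_unitality (X : CMet.{u}) :
    (λ_ (P X)).hom = (dirac (𝟙_ CMet) ⊗ₘ 𝟙 (P X)) ≫ joint (𝟙_ CMet) X ≫ push (λ_ X).hom :=
  hom_ext_P fun z f hf => by
    refine Eq.symm ((integral_push (λ_ X).hom _ hf).trans
      ((integral_joint _ (short_comp (λ_ X).hom hf)).trans ?_))
    exact integral_dirac (X := 𝟙_ CMet) z.fst _

theorem joint_right_unitality (X : CMet.{u}) :
    (ρ_ (P X)).hom = (𝟙 (P X) ⊗ₘ dirac (𝟙_ CMet)) ≫ joint X (𝟙_ CMet) ≫ push (ρ_ X).hom :=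
  hom_ext_P fun z f hf => by
    refine Eq.symm ((integral_push (ρ_ X).hom _ hf).trans
      ((integral_joint _ (short_comp (ρ_ X).hom hf)).trans ?_))
    exact integral_congr_ae (Eventually.of_forall fun x =>
      integral_dirac (X := 𝟙_ CMet) z.snd _)

theorem joint_braided (X Y : CMet.{u}) :
    joint X Y ≫ push (β_ X Y).hom = (β_ (P X) (P Y)).hom ≫ joint Y X :=
  hom_ext_P fun z f hf => by
    refine (integral_push (β_ X Y).hom _ hf).trans
      ((integral_joint z (short_comp (β_ X Y).hom hf)).trans ?_)
    exact (Kant.integral_integral_swap z.fst z.snd (short_comp (β_ X Y).hom hf)).trans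
      (integral_joint (X := Y) (Y := X) ⟨z.snd, z.fst⟩ hf).symm

/-! ### Coherence of the marginals -/

theorem hom_ext_prod {X Y Z : CMet.{u}} {g h : Z ⟶ X ⊗ Y}
    (h₁ : g ≫ proj₁ X Y = h ≫ proj₁ X Y) (h₂ : g ≫ proj₂ X Y = h ≫ proj₂ X Y) : g = h :=
  hom_ext fun z => L1Prod.ext (congrFun (congrArg Hom.toFun h₁) z)
    (congrFun (congrArg Hom.toFun h₂) z)

theorem tensorHom_proj₁ {X X' Y Y' : CMet.{u}} (g : X ⟶ X') (h : Y ⟶ Y') :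
    (g ⊗ₘ h) ≫ proj₁ X' Y' = proj₁ X Y ≫ g := rfl

theorem tensorHom_proj₂ {X X' Y Y' : CMet.{u}} (g : X ⟶ X') (h : Y ⟶ Y') :
    (g ⊗ₘ h) ≫ proj₂ X' Y' = proj₂ X Y ≫ h := rfl

theorem marginals_proj₁ (X Y : CMet.{u}) :
    marginals X Y ≫ proj₁ (P X) (P Y) = push (proj₁ X Y) := rfl

theorem marginals_proj₂ (X Y : CMet.{u}) :
    marginals X Y ≫ proj₂ (P X) (P Y) = push (proj₂ X Y) := rfl

theorem push_id (X : CMet.{u}) : push (𝟙 X) = 𝟙 (P X) := kantorovichMonad.map_id X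

theorem push_comp {X Y Z : CMet.{u}} (g : X ⟶ Y) (h : Y ⟶ Z) : push (g ≫ h) = push g ≫ push h :=
  kantorovichMonad.map_comp g h

theorem marginals_natural {X X' Y Y' : CMet.{u}} (g : X ⟶ X') (h : Y ⟶ Y') :
    marginals X Y ≫ (push g ⊗ₘ push h) = push (g ⊗ₘ h) ≫ marginals X' Y' :=
  hom_ext_prod
    ((push_comp (proj₁ X Y) g).symm.trans (push_comp (g ⊗ₘ h) (proj₁ X' Y')))
    ((push_comp (proj₂ X Y) h).symm.trans (push_comp (g ⊗ₘ h) (proj₂ X' Y')))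

theorem marginals_associativity (X Y Z : CMet.{u}) :
    marginals (X ⊗ Y) Z ≫ (marginals X Y ⊗ₘ 𝟙 (P Z)) ≫ (α_ (P X) (P Y) (P Z)).hom =
      push (α_ X Y Z).hom ≫ marginals X (Y ⊗ Z) ≫ (𝟙 (P X) ⊗ₘ marginals Y Z) :=
  hom_ext_prod
    ((push_comp (proj₁ (X ⊗ Y) Z) (proj₁ X Y)).symm.trans
      (push_comp (α_ X Y Z).hom (proj₁ X (Y ⊗ Z))))
    (hom_ext_prod
      ((push_comp (proj₁ (X ⊗ Y) Z) (proj₂ X Y)).symm.trans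
        ((push_comp (α_ X Y Z).hom (proj₂ X (Y ⊗ Z) ≫ proj₁ Y Z)).trans
          (congrArg (push (α_ X Y Z).hom ≫ ·) (push_comp _ _))))
      ((push_comp (α_ X Y Z).hom (proj₂ X (Y ⊗ Z) ≫ proj₂ Y Z)).trans
          (congrArg (push (α_ X Y Z).hom ≫ ·) (push_comp _ _))))

/-- The map to the one-point space; the counit of `P` is the case of `P 𝟙`. -/
def toUnit (X : CMet.{u}) : X ⟶ 𝟙_ CMet.{u} :=
  mkHom (fun _ => PUnit.unit) fun _ _ => by simp

theorem marginals_left_unitality (X : CMet.{u}) :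
    (λ_ (P X)).inv
      = push (λ_ X).inv ≫ marginals (𝟙_ CMet) X ≫ (toUnit (P (𝟙_ CMet)) ⊗ₘ 𝟙 (P X)) :=
  hom_ext_prod rfl ((push_id X).symm.trans (push_comp (λ_ X).inv (proj₂ (𝟙_ CMet) X)))

theorem marginals_right_unitality (X : CMet.{u}) :
    (ρ_ (P X)).inv
      = push (ρ_ X).inv ≫ marginals X (𝟙_ CMet) ≫ (𝟙 (P X) ⊗ₘ toUnit (P (𝟙_ CMet))) :=
  hom_ext_prod ((push_id X).symm.trans (push_comp (ρ_ X).inv (proj₁ X (𝟙_ CMet)))) rfl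

theorem marginals_braided (X Y : CMet.{u}) :
    push (β_ X Y).hom ≫ marginals Y X = marginals X Y ≫ (β_ (P X) (P Y)).hom :=
  hom_ext_prod (push_comp (β_ X Y).hom (proj₁ Y X)).symm (push_comp (β_ X Y).hom (proj₂ Y X)).symm

/-! ### Bimonoidality and the monad structure -/

/-- Bimonoidality. On the two components, swapping the middle factors and projecting is the tensor
product of the projections, so each component is a naturality square of `∇`. -/
theorem joint_marginals_bimonoidality (W X Y Z : CMet.{u}) :
    joint (W ⊗ X) (Y ⊗ Z) ≫ push (tensorμ W X Y Z) ≫ marginals (W ⊗ Y) (X ⊗ Z) =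
      (marginals W X ⊗ₘ marginals Y Z) ≫ tensorμ (P W) (P X) (P Y) (P Z) ≫
        (joint W Y ⊗ₘ joint X Z) :=
  hom_ext_prod
    ((congrArg (joint (W ⊗ X) (Y ⊗ Z) ≫ ·)
      (push_comp (tensorμ W X Y Z) (proj₁ (W ⊗ Y) (X ⊗ Z))).symm).trans
      (joint_natural (proj₁ W X) (proj₁ Y Z)).symm)
    ((congrArg (joint (W ⊗ X) (Y ⊗ Z) ≫ ·)
      (push_comp (tensorμ W X Y Z) (proj₂ (W ⊗ Y) (X ⊗ Z))).symm).trans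
      (joint_natural (proj₂ W X) (proj₂ Y Z)).symm)

theorem dirac_natural {X Y : CMet.{u}} (g : X ⟶ Y) : g ≫ dirac Y = dirac X ≫ push g :=
  kantorovichMonad.η.naturality g

theorem average_natural {X Y : CMet.{u}} (g : X ⟶ Y) :
    push (push g) ≫ average Y = average X ≫ push g :=
  kantorovichMonad.μ.naturality g

theorem dirac_joint (X Y : CMet.{u}) : (dirac X ⊗ₘ dirac Y) ≫ joint X Y = dirac (X ⊗ Y) :=
  hom_ext_P fun z f hf => by
    refine (integral_joint _ hf).trans ((integral_dirac z.fst _).trans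
      ((integral_dirac z.snd _).trans (integral_dirac (X := X ⊗ Y) z f).symm))

theorem dirac_marginals (X Y : CMet.{u}) :
    dirac (X ⊗ Y) ≫ marginals X Y = (dirac X ⊗ₘ dirac Y) :=
  hom_ext_prod (dirac_natural (proj₁ X Y)).symm (dirac_natural (proj₂ X Y)).symm

/-- The average commutes with `∇`. Averaging in the first argument gives `∫ p` as the outer integral
on both sides; for fixed `p`, Fubini's theorem makes `y ↦ ∫ f(x, y) dp(x)` the test function
against which the laws on `Y` are averaged. -/
theorem average_joint (X Y : CMet.{u}) :
    (joint (P X) (P Y) ≫ push (joint X Y)) ≫ average (X ⊗ Y)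
      = (average X ⊗ₘ average Y) ≫ joint X Y :=
  hom_ext_P fun z f hf => by
    have hI := short_int (X := X ⊗ Y) hf
    refine (integral_average (X := X ⊗ Y) _ hf).trans ((integral_push (joint X Y) _ hI).trans
      ((integral_joint z (short_comp (joint X Y) hI)).trans ?_))
    refine Eq.trans ?_ (integral_joint _ hf).symm
    refine Eq.trans ?_ (integral_average z.fst (Kant.short_integral_right _ hf)).symm
    refine integral_congr_ae (Eventually.of_forall fun p => ?_)
    refine (integral_congr_ae (Eventually.of_forall fun q =>
      (integral_joint (X := X) (Y := Y) ⟨p, q⟩ hf).trans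
        (Kant.integral_integral_swap p q hf))).trans ?_
    refine (integral_average z.snd (Kant.short_integral_left p hf)).symm.trans ?_
    exact (Kant.integral_integral_swap p ((average Y).toFun z.snd) hf).symm

theorem average_marginals (X Y : CMet.{u}) :
    average (X ⊗ Y) ≫ marginals X Y
      = (push (marginals X Y) ≫ marginals (P X) (P Y)) ≫ (average X ⊗ₘ average Y) := by
  refine hom_ext_prod ?_ ?_
  · rw [Category.assoc, Category.assoc, Category.assoc, tensorHom_proj₁, marginals_proj₁,
      ← average_natural, ← marginals_proj₁ X Y, push_comp, Category.assoc,
      ← marginals_proj₁ (P X) (P Y), Category.assoc]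
  · rw [Category.assoc, Category.assoc, Category.assoc, tensorHom_proj₂, marginals_proj₂,
      ← average_natural, ← marginals_proj₂ X Y, push_comp, Category.assoc,
      ← marginals_proj₂ (P X) (P Y), Category.assoc]

/-- The product joint makes `P` lax monoidal; the unit is the Dirac measure on the one-point
space. -/
noncomputable instance : kantorovichMonad.{u}.toFunctor.LaxMonoidal where
  ε := dirac (𝟙_ CMet)
  μ := joint
  μ_natural_left {X Y} f X' := by
    have := joint_natural f (𝟙 X')
    rwa [push_id, tensorHom_id, tensorHom_id] at this
  μ_natural_right X' f := by
    have := joint_natural (𝟙 X') f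
    rwa [push_id, id_tensorHom, id_tensorHom] at this
  associativity := joint_associativity
  left_unitality := joint_left_unitality
  right_unitality := joint_right_unitality

/-- The marginals make `P` oplax monoidal; the counit is the only map to the one-point space. -/
noncomputable instance : kantorovichMonad.{u}.toFunctor.OplaxMonoidal where
  η := toUnit (P (𝟙_ CMet))
  δ := marginals
  δ_natural_left f X' := by
    have := marginals_natural f (𝟙 X')
    rwa [push_id, tensorHom_id, tensorHom_id] at this
  δ_natural_right X' f := by
    have := marginals_natural (𝟙 X') f
    rwa [push_id, id_tensorHom, id_tensorHom] at this
  oplax_associativity := marginals_associativity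
  oplax_left_unitality := marginals_left_unitality
  oplax_right_unitality := marginals_right_unitality

noncomputable instance : SymmetricBilaxMonoidal kantorovichMonad.{u}.toFunctor where
  braided := joint_braided
  cobraided := marginals_braided
  bimonoidality := joint_marginals_bimonoidality
  unit_counit := rfl
  unit_comul := hom_ext_prod
    ((congrArg (dirac _ ≫ ·) (push_comp (λ_ (𝟙_ CMet)).inv (proj₁ _ _)).symm).trans
      (dirac_natural _).symm)
    ((congrArg (dirac _ ≫ ·) (push_comp (λ_ (𝟙_ CMet)).inv (proj₂ _ _)).symm).trans
      (dirac_natural _).symm)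
  mul_counit := rfl

noncomputable instance : SymmetricBimonoidalMonad kantorovichMonad.{u} where
  unit_bilax :=
    { lax :=
        { unit := Category.id_comp _
          tensor := fun X Y => (Category.id_comp _).trans (dirac_joint X Y).symm }
      oplax :=
        { counit := rfl
          comul := fun X Y => (dirac_marginals X Y).trans (Category.id_comp _).symm } }
  mul_bilax :=
    { lax :=
        { unit := (Category.assoc _ _ _).trans ((congrArg (dirac (𝟙_ CMet) ≫ ·)
            (kantorovichMonad.right_unit (𝟙_ CMet))).trans (Category.comp_id _))
          tensor := average_joint }
      oplax :=
        { counit := rfl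
          comul := average_marginals } }

end CMet

theorem mainTheorem1 :
    ∃ S : SymmetricBimonoidalMonad CMet.kantorovichMonad.{u},
      (∀ (X Y : CMet.{u}) (p : CMet.P X) (q : CMet.P Y),
        CMet.IsProductJoint p q ((S.toLaxMonoidal.μ X Y).toFun ⟨p, q⟩)) ∧
      (∀ (X Y : CMet.{u}) (r : CMet.P (X ⊗ Y)),
        CMet.IsPairOfMarginals r ((S.toOplaxMonoidal.δ X Y).toFun r).fst ((S.toOplaxMonoidal.δ X Y).toFun r).snd) := by
  refine ⟨inferInstance, fun X Y p q f hf => ?_, fun X Y r =>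
    ⟨fun f hf => CMet.integral_push (CMet.proj₁ X Y) r hf,
      fun g hg => CMet.integral_push (CMet.proj₂ X Y) r hg⟩⟩
  have h := CMet.integral_productJoint p q hf
  exact ⟨h, h.trans (Kant.integral_integral_swap p q hf)⟩
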